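/- Let $M$ be a von Neumann algebra with a faithful normal finite trace $\tau$. Let $L^1(M,\tau)$ be the completion of $M$ in the norm $\|x\|_1=\tau(|x|)$, let $L^1(M_{sa},\tau)$ be the closure in it of the self-adjoint part of $M$, call $u\in L^1(M,\tau)$ positive ($u\ge 0$) if it lies in the closure of the cone of positive elements of $M$, and denote the continuous extension of $\tau$ to $L^1(M,\tau)$ again by $\tau$. Let $T:L^1(M,\tau)\to L^1(M,\tau)$ be a bounded linear operator with $\|Tx\|_1\le\|x\|_1$ for all $x\in L^1(M_{sa},\tau)$, and suppose that either $\|Tx\|_1\le\|x\|_1$ holds for all $x\in L^1(M,\tau)$, or $T$ maps $L^1(M_{sa},\tau)$ into itself. Put $$\bar\rho(T)=\sup\Big\{\lim_{n\to\infty}\frac{\|T^n(u-v)\|_1}{\|u-v\|_1}\;:\;u,v\ge 0,\ \|u\|_1=\|v\|_1,\ u\ne v\Big\},\qquad \rho(T)=\lim_{n\to\infty}\|T^n\|-\bar\rho(T),$$ where $\|T^n\|$ is the operator norm on $L^1(M,\tau)$, $\sup\emptyset=0$, and $\lim_n\|T^n\|$ is read as $\liminf_n\|T^n\|$. Then the limits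 and the supremum defining $\bar\rho(T)$ exist and are finite, the sequence $(\|T^n\|)_n$ is bounded, and it converges if $\|Tx\|_1\le\|x\|_1$ for all $x\in L^1(M,\tau)$. Moreover, for every $x\in L^1(M_{sa},\tau)$ the limit $\lim_n\|T^nx\|_1$ exists and $$\lim_{n\to\infty}\|T^nx\|_1\le\bar\rho(T)\,\|x\|_1+\rho(T)\,|\tau(x)|.$$ -/

import Mathlib

open scoped ComplexOrder

/-- A faithful normal finite trace on a von Neumann algebra `M`: a positive linear functional
`τ : M → ℂ` with `τ (x y) = τ (y x)`, vanishing on no nonzero `x⋆ x`, and preserving least upper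
bounds of upward directed families of positive elements. -/
structure FaithfulNormalTrace (M : Type*) [CStarAlgebra M] [PartialOrder M]
    extends M →ₚ[ℂ] ℂ where
  trace_comm : ∀ x y : M, toFun (x * y) = toFun (y * x)
  faithful : ∀ x : M, toFun (star x * x) = 0 → x = 0
  normal : ∀ (D : Set M) (s : M), D.Nonempty → (∀ x ∈ D, 0 ≤ x) → DirectedOn (· ≤ ·) D →
    IsLUB D s → IsLUB ((fun x => (toFun x).re) '' D) (toFun s).re

namespace FaithfulNormalTrace

variable {M : Type*} [CStarAlgebra M] [PartialOrder M]

noncomputable instance : CoeFun (FaithfulNormalTrace M) (fun _ => M → ℂ) :=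
  ⟨fun τ => τ.toPositiveLinearMap⟩

theorem comm (τ : FaithfulNormalTrace M) (x y : M) : τ (x * y) = τ (y * x) :=
  τ.trace_comm x y

theorem re_mono (τ : FaithfulNormalTrace M) {x y : M} (h : x ≤ y) : (τ x).re ≤ (τ y).re :=
  (Complex.le_def.1 (τ.toPositiveLinearMap.monotone' h)).1

theorem re_smul (τ : FaithfulNormalTrace M) (r : ℝ) (x : M) : (τ (r • x)).re = r * (τ x).re := by
  rw [← Complex.coe_smul, map_smul]; simp

theorem re_nonneg (τ : FaithfulNormalTrace M) {x : M} (h : 0 ≤ x) : 0 ≤ (τ x).re := by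
  simpa using τ.re_mono h

variable [StarOrderedRing M]

/-- `‖x‖₁ = τ(|x|)`, where `|x| = (x⋆ x)^{1/2}`. The value `τ(|x|)` is a nonnegative real. -/
noncomputable def norm₁ (τ : FaithfulNormalTrace M) (x : M) : ℝ := (τ (CFC.abs x)).re

theorem norm₁_nonneg (τ : FaithfulNormalTrace M) (x : M) : 0 ≤ τ.norm₁ x :=
  τ.re_nonneg (CFC.abs_nonneg x)

theorem cauchy_schwarz (τ : FaithfulNormalTrace M) (a b : M) :
    ‖τ (a * b)‖ ^ 2 ≤ (τ (a * star a)).re * (τ (star b * b)).re := by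
  have h := norm_inner_le_norm (𝕜 := ℂ) (τ.toPositiveLinearMap.toPreGNS (star a))
    (τ.toPositiveLinearMap.toPreGNS b)
  rw [PositiveLinearMap.preGNS_inner_def, PositiveLinearMap.preGNS_norm_def,
    PositiveLinearMap.preGNS_norm_def] at h
  simp only [PositiveLinearMap.ofPreGNS_toPreGNS, star_star] at h
  have h2 := pow_le_pow_left₀ (norm_nonneg _) h 2
  rw [mul_pow, Real.sq_sqrt, Real.sq_sqrt] at h2
  · exact h2
  · exact τ.re_nonneg (star_mul_self_nonneg b)
  · exact τ.re_nonneg (mul_star_self_nonneg a)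

/-- A regularised inverse of `|x|`. -/
theorem exists_reg_inverse (x : M) {ε : ℝ} (hε : 0 < ε) :
    ∃ q : M, 0 ≤ q ∧ q * (CFC.abs x + ε • 1) = 1 ∧ (CFC.abs x + ε • 1) * q = 1 ∧
      0 ≤ CFC.abs x * q ∧ CFC.abs x * q ≤ 1 ∧ Commute (CFC.abs x) q := by
  set p := CFC.abs x with hp
  have hp0 : 0 ≤ p := CFC.abs_nonneg x
  have hb : algebraMap ℝ M ε ≤ p + ε • 1 := by
    rw [Algebra.algebraMap_eq_smul_one]; exact le_add_of_nonneg_left hp0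
  have hb0 : 0 ≤ p + ε • (1 : M) := add_nonneg hp0 (smul_nonneg hε.le zero_le_one)
  have hu : IsUnit (p + ε • (1 : M)) :=
    CStarAlgebra.isUnit_of_le _ hb
      ⟨algebraMap_nonneg M hε.le, (isUnit_iff_ne_zero.2 hε.ne').map (algebraMap ℝ M)⟩
  obtain ⟨u, hu⟩ := hu
  have hq0 : 0 ≤ (↑u⁻¹ : M) := by
    have := hb0
    rw [← hu] at this
    exact CFC.inv_nonneg_of_nonneg u this
  have hcomm : Commute p (↑u⁻¹ : M) := by
    apply Commute.units_inv_right
    rw [hu]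
    exact (Commute.refl p).add_right ((Commute.one_right p).smul_right ε)
  have h1 : (↑u⁻¹ : M) * (p + ε • 1) = 1 := by rw [← hu]; simp
  have h2 : (p + ε • 1) * (↑u⁻¹ : M) = 1 := by rw [← hu]; simp
  refine ⟨_, hq0, h1, h2, hcomm.mul_nonneg hp0 hq0, ?_, hcomm⟩
  rw [add_mul, smul_mul_assoc, one_mul] at h2
  rw [← h2]
  exact le_add_of_nonneg_right (smul_nonneg hε.le hq0)

theorem norm_apply_mul_le (τ : FaithfulNormalTrace M) (y x : M) :
    ‖τ (y * x)‖ ≤ ‖y‖ * τ.norm₁ x := by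
  have hN := τ.norm₁_nonneg x
  have key : ∀ ε : ℝ, 0 < ε →
      ‖τ (y * x)‖ ^ 2 ≤ ‖y‖ ^ 2 * (τ.norm₁ x + ε * (τ 1).re) * τ.norm₁ x := by
    intro ε hε
    obtain ⟨q, hq0, h1, h2, hr0, hr1, hcomm⟩ := exists_reg_inverse x hε
    have hp0 : 0 ≤ CFC.abs x := CFC.abs_nonneg x
    have habs := CFC.abs_mul_abs x
    unfold norm₁
    set p := CFC.abs x with hp
    set b := p + ε • (1 : M) with hb
    have hb0 : 0 ≤ b := add_nonneg hp0 (smul_nonneg hε.le zero_le_one)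
    set k := CFC.sqrt q with hk
    have hkk : k * k = q := CFC.sqrt_mul_sqrt_self q hq0
    have hks : star k = k := (CFC.sqrt_nonneg q).star_eq
    have hbs : star b = b := hb0.star_eq
    have e1 : τ (y * x) = τ ((k * b * y) * (x * k)) := by
      rw [← τ.comm (x * k) (k * b * y)]
      rw [show x * k * (k * b * y) = x * ((k * k) * b) * y by simp only [mul_assoc], hkk, h1,
        mul_one, τ.comm]
    rw [e1]
    refine (τ.cauchy_schwarz _ _).trans ?_
    have hA : (τ ((k * b * y) * star (k * b * y))).re ≤
        ‖y‖ ^ 2 * ((τ p).re + ε * (τ 1).re) := by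
      have hy : y * star y ≤ (‖y‖ ^ 2) • (1 : M) := by
        have := IsSelfAdjoint.le_algebraMap_norm_self (IsSelfAdjoint.mul_star_self y)
        rwa [CStarRing.norm_self_mul_star, ← sq, Algebra.algebraMap_eq_smul_one] at this
      have h3 : (k * b) * (y * star y) * star (k * b) ≤
          (k * b) * ((‖y‖ ^ 2) • (1 : M)) * star (k * b) := star_right_conjugate_le_conjugate hy _
      have h4 := τ.re_mono h3
      have e2 : (k * b) * ((‖y‖ ^ 2) • (1 : M)) * star (k * b) =
          (‖y‖ ^ 2) • ((k * b) * star (k * b)) := by simp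
      have e3 : τ ((k * b) * star (k * b)) = τ b := by
        rw [τ.comm, star_mul, hks, hbs,
          show b * k * (k * b) = b * ((k * k) * b) by simp only [mul_assoc], hkk, h1, mul_one]
      have e4 : (τ b).re = (τ p).re + ε * (τ 1).re := by
        rw [hb, map_add, Complex.add_re, τ.re_smul]
      rw [e2, τ.re_smul, e3, e4] at h4
      rw [star_mul]
      calc _ = (τ ((k * b) * (y * star y) * star (k * b))).re := by simp only [mul_assoc]
        _ ≤ _ := h4
    have hB : (τ (star (x * k) * (x * k))).re ≤ (τ p).re := by
      have e2 : τ (star (x * k) * (x * k)) = τ (p * (p * q)) := by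
        rw [star_mul, hks,
          show k * star x * (x * k) = k * (star x * x * k) by simp only [mul_assoc], τ.comm,
          ← habs, show p * p * k * k = p * (p * (k * k)) by simp only [mul_assoc], hkk]
      rw [e2]
      apply τ.re_mono
      have h5 : p * q + ε • q = 1 := by
        rw [hb, add_mul, smul_mul_assoc, one_mul] at h2; exact h2
      have h6 : p = p * (p * q) + ε • (p * q) := by
        conv_lhs => rw [← mul_one p, ← h5, mul_add, mul_smul_comm]
      conv_rhs => rw [h6]
      exact le_add_of_nonneg_right (smul_nonneg hε.le hr0)
    exact mul_le_mul hA hB (τ.re_nonneg (star_mul_self_nonneg _))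
      (by have := τ.re_nonneg hp0; have := τ.re_nonneg (zero_le_one (α := M)); positivity)
  have hlim : Filter.Tendsto
      (fun ε : ℝ => ‖y‖ ^ 2 * (τ.norm₁ x + ε * (τ 1).re) * τ.norm₁ x)
      (nhdsWithin 0 (Set.Ioi 0)) (nhds (‖y‖ ^ 2 * (τ.norm₁ x + 0 * (τ 1).re) * τ.norm₁ x)) := by
    apply Filter.Tendsto.mono_left _ nhdsWithin_le_nhds
    exact Continuous.tendsto (by fun_prop) 0
  have h := ge_of_tendsto hlim (Filter.eventually_of_mem self_mem_nhdsWithin key)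
  rw [zero_mul, add_zero] at h
  refine (sq_le_sq₀ (norm_nonneg _) (by positivity)).1 (h.trans_eq (by ring))

theorem exists_norm₁_le (τ : FaithfulNormalTrace M) (x : M) {ε : ℝ} (hε : 0 < ε) :
    ∃ y : M, ‖y‖ ≤ 1 ∧ τ.norm₁ x ≤ ‖τ (y * x)‖ + ε * (τ 1).re := by
  obtain ⟨q, hq0, h1, h2, hr0, hr1, hcomm⟩ := exists_reg_inverse x hε
  have habs := CFC.abs_mul_abs x
  unfold norm₁
  set p := CFC.abs x with hp
  have h5 : p * q + ε • q = 1 := by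
    rw [add_mul, smul_mul_assoc, one_mul] at h2; exact h2
  refine ⟨q * star x, ?_, ?_⟩
  · have hr : ‖p * q‖ ≤ 1 := (CStarAlgebra.norm_le_one_iff_of_nonneg _ hr0).2 hr1
    have e : (q * star x) * star (q * star x) = (p * q) * (p * q) := by
      rw [star_mul, star_star, hq0.star_eq,
        show q * star x * (x * q) = q * (star x * x) * q by simp only [mul_assoc], ← habs]
      rw [← mul_assoc q p p, ← hcomm.eq]
      simp only [mul_assoc]
    have h6 : ‖q * star x‖ ^ 2 ≤ 1 := by
      rw [sq, ← CStarRing.norm_self_mul_star, e]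
      exact (norm_mul_le _ _).trans (mul_le_one₀ hr (norm_nonneg _) hr)
    exact (sq_le_one_iff₀ (norm_nonneg _)).1 h6
  · have e : q * star x * x = p * (p * q) := by
      rw [mul_assoc, ← habs, ← mul_assoc q p p, ← hcomm.eq, mul_assoc, ← hcomm.eq]
    have h6 : p = p * (p * q) + ε • (p * q) := by
      conv_lhs => rw [← mul_one p, ← h5, mul_add, mul_smul_comm]
    have h7 : (τ p).re = (τ (p * (p * q))).re + ε * (τ (p * q)).re := by
      conv_lhs => rw [h6]
      rw [map_add, Complex.add_re, τ.re_smul]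
    rw [e, h7]
    exact add_le_add (Complex.re_le_norm _) (mul_le_mul_of_nonneg_left (τ.re_mono hr1) hε.le)

theorem norm₁_add_le (τ : FaithfulNormalTrace M) (x y : M) :
    τ.norm₁ (x + y) ≤ τ.norm₁ x + τ.norm₁ y := by
  have key : ∀ ε : ℝ, 0 < ε → τ.norm₁ (x + y) ≤ τ.norm₁ x + τ.norm₁ y + ε * (τ 1).re := by
    intro ε hε
    obtain ⟨z, hz, h⟩ := τ.exists_norm₁_le (x + y) hε
    refine h.trans (add_le_add_left ?_ _)
    rw [mul_add, map_add]
    refine (norm_add_le _ _).trans (add_le_add ?_ ?_)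
    · exact (τ.norm_apply_mul_le z x).trans (mul_le_of_le_one_left (τ.norm₁_nonneg x) hz)
    · exact (τ.norm_apply_mul_le z y).trans (mul_le_of_le_one_left (τ.norm₁_nonneg y) hz)
  have hlim : Filter.Tendsto (fun ε : ℝ => τ.norm₁ x + τ.norm₁ y + ε * (τ 1).re)
      (nhdsWithin 0 (Set.Ioi 0)) (nhds (τ.norm₁ x + τ.norm₁ y + 0 * (τ 1).re)) := by
    apply Filter.Tendsto.mono_left _ nhdsWithin_le_nhds
    exact Continuous.tendsto (by fun_prop) 0
  have h := ge_of_tendsto hlim (Filter.eventually_of_mem self_mem_nhdsWithin key)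
  simpa using h

theorem norm_apply_le (τ : FaithfulNormalTrace M) (x : M) : ‖τ x‖ ≤ τ.norm₁ x := by
  rcases subsingleton_or_nontrivial M with hM | hM
  · rw [Subsingleton.elim x 0, map_zero, norm_zero]; exact τ.norm₁_nonneg _
  · simpa using τ.norm_apply_mul_le 1 x

end FaithfulNormalTrace

/-- The space `M` regarded with the norm `‖x‖₁ = τ(|x|)` (a type synonym of `M`). -/
@[nolint unusedArguments]
def TraceNormed {M : Type*} [CStarAlgebra M] [PartialOrder M] (_τ : FaithfulNormalTrace M) :
    Type _ := M

namespace TraceNormed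

variable {M : Type*} [CStarAlgebra M] [PartialOrder M] (τ : FaithfulNormalTrace M)

noncomputable instance : AddCommGroup (TraceNormed τ) := inferInstanceAs (AddCommGroup M)
noncomputable instance : Module ℂ (TraceNormed τ) := inferInstanceAs (Module ℂ M)

/-- The identity map from `M` to `M` with the norm `‖·‖₁`. -/
noncomputable def of : M ≃ₗ[ℂ] TraceNormed τ := LinearEquiv.refl ℂ M

variable [StarOrderedRing M]

noncomputable instance : SeminormedAddCommGroup (TraceNormed τ) :=
  AddGroupSeminorm.toSeminormedAddCommGroup
    { toFun := fun x => τ.norm₁ ((of τ).symm x)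
      map_zero' := by simp [FaithfulNormalTrace.norm₁]
      add_le' := fun x y => by
        rw [map_add]
        exact τ.norm₁_add_le ((of τ).symm x) ((of τ).symm y)
      neg' := fun x => by simp [FaithfulNormalTrace.norm₁] }

theorem norm_def (x : TraceNormed τ) : ‖x‖ = τ.norm₁ ((of τ).symm x) := rfl

theorem norm_of (x : M) : ‖of τ x‖ = (τ (CFC.abs x)).re := rfl

noncomputable instance : NormedSpace ℂ (TraceNormed τ) where
  norm_smul_le c x := by
    rw [norm_def, norm_def, map_smul, FaithfulNormalTrace.norm₁, FaithfulNormalTrace.norm₁,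
      CFC.abs_smul, τ.re_smul]

/-- The trace as a bounded functional for `‖·‖₁`. -/
noncomputable def traceCLM : TraceNormed τ →L[ℂ] ℂ :=
  (τ.toPositiveLinearMap.toLinearMap ∘ₗ (of τ).symm.toLinearMap).mkContinuous 1 fun x => by
    rw [one_mul]; exact τ.norm_apply_le ((of τ).symm x)

end TraceNormed

/-- `L¹(M, τ)`: the completion of `M` with respect to `‖x‖₁ = τ(|x|)`. -/
abbrev NCL1 {M : Type*} [CStarAlgebra M] [PartialOrder M] [StarOrderedRing M]
    (τ : FaithfulNormalTrace M) : Type _ := UniformSpace.Completion (TraceNormed τ)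

namespace NCL1

variable {M : Type*} [CStarAlgebra M] [PartialOrder M] [StarOrderedRing M]
  (τ : FaithfulNormalTrace M)

/-- The canonical dense embedding of `M` into `L¹(M, τ)`. -/
noncomputable def ofAlg : M →ₗ[ℂ] NCL1 τ :=
  (UniformSpace.Completion.toComplL : TraceNormed τ →L[ℂ] NCL1 τ).toLinearMap ∘ₗ
    (TraceNormed.of τ).toLinearMap

/-- `L¹(M_sa, τ)`: the closure in `L¹(M, τ)` of the self-adjoint part of `M`, that is, the
completion of `M_sa` with respect to `‖·‖₁`. -/
def selfAdjointPart : Set (NCL1 τ) := closure (ofAlg τ '' {x : M | IsSelfAdjoint x})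

/-- The cone of positive elements of `L¹(M, τ)`: the closure of the cone of positive elements
of `M`. -/
def positiveCone : Set (NCL1 τ) := closure (ofAlg τ '' {x : M | 0 ≤ x})

/-- The trace on `L¹(M, τ)`: the continuous linear extension of `τ`. -/
noncomputable def trace : NCL1 τ →L[ℂ] ℂ :=
  (TraceNormed.traceCLM τ).extend
    (UniformSpace.Completion.toComplL : TraceNormed τ →L[ℂ] NCL1 τ)

theorem trace_ofAlg (x : M) : trace τ (ofAlg τ x) = τ x :=
  (TraceNormed.traceCLM τ).extend_eq
    (e := (UniformSpace.Completion.toComplL : TraceNormed τ →L[ℂ] NCL1 τ))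
    UniformSpace.Completion.denseRange_coe
    (UniformSpace.Completion.isUniformInducing_coe _) (TraceNormed.of τ x)

theorem norm_ofAlg (x : M) : ‖ofAlg τ x‖ = (τ (CFC.abs x)).re :=
  UniformSpace.Completion.norm_coe (TraceNormed.of τ x)

variable {τ}

/-- The limits `lim_n ‖T^n (u - v)‖₁ / ‖u - v‖₁` over distinct positive `u, v` with
`‖u‖₁ = ‖v‖₁`. -/
def asymptoticRatios (T : NCL1 τ →L[ℂ] NCL1 τ) : Set ℝ :=
  {r | ∃ u ∈ positiveCone τ, ∃ v ∈ positiveCone τ, ‖u‖ = ‖v‖ ∧ u ≠ v ∧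
    Filter.Tendsto (fun n : ℕ => ‖(T ^ n) (u - v)‖ / ‖u - v‖) Filter.atTop (nhds r)}

/-- `ρ̄(T)`, the supremum of the asymptotic ratios (`0` if there are none). -/
noncomputable def rhoBar (T : NCL1 τ →L[ℂ] NCL1 τ) : ℝ := sSup (asymptoticRatios T)

/-- The asymptotic norm `lim_n ‖T^n‖`, with the operator norm on `L¹(M, τ)`; it is written with the
lower limit, which is the limit whenever the limit exists. -/
noncomputable def asymptoticNorm (T : NCL1 τ →L[ℂ] NCL1 τ) : ℝ :=
  Filter.liminf (fun n : ℕ => ‖T ^ n‖) Filter.atTop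

/-- The asymptotic Dobrushin coefficient of ergodicity `ρ(T) = lim_n ‖T^n‖ - ρ̄(T)`. -/
noncomputable def rho (T : NCL1 τ →L[ℂ] NCL1 τ) : ℝ := asymptoticNorm T - rhoBar T

end NCL1

/-!
Every iterate of `T` contracts the self-adjoint part of `L¹(M, τ)`: under the first alternative
because `‖T‖ ≤ 1`, under the second because `T` preserves that part. Hence `‖T^n x‖₁` is
nonincreasing and convergent for self-adjoint `x`, which settles the existence of all the limits and
bounds the asymptotic ratios by `1`. Under the second alternative `‖T^n‖ ≤ 2` follows by splitting an
element of `M` into its real and imaginary parts, whose `‖·‖₁`-norms do not exceed its own, since the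
adjoint is isometric for `‖·‖₁`.

For the inequality, let `x ∈ M` be self-adjoint with `τ(x) ≥ 0`, and put `c = τ(x⁻) / τ(x⁺) ≤ 1`. Then
`x = (c x⁺ - x⁻) + (1 - c) x⁺`. The first summand is a difference of positive elements of equal norm
`τ(x⁻)`, so asymptotically it contributes at most
`ρ̄(T) · 2 τ(x⁻) = ρ̄(T) (‖x‖₁ - τ(x))`; the second is positive of norm `τ(x)` and contributes at most
`(liminf ‖T^n‖) τ(x)`. The sum of the two bounds is `ρ̄(T) ‖x‖₁ + ρ(T) τ(x)`
(`NCL1.limit_le_of_trace_nonneg`). The case `τ(x) ≤ 0` follows by passing to `-x`, and general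
self-adjoint `x` by density of `M_sa`.
-/

open Filter Topology

/-! ### Limits of powers of a bounded operator -/

theorem ContinuousLinearMap.le_liminf_norm_pow_mul {E : Type*} [NormedAddCommGroup E]
    [NormedSpace ℂ E] {T : E →L[ℂ] E} (hbdd : BddAbove (Set.range fun n : ℕ => ‖T ^ n‖))
    {y : E} {l : ℝ} (hl : Tendsto (fun n : ℕ => ‖(T ^ n) y‖) atTop (𝓝 l)) :
    l ≤ liminf (fun n : ℕ => ‖T ^ n‖) atTop * ‖y‖ := by
  rcases eq_or_ne y 0 with rfl | hy
  · simp only [map_zero, norm_zero, mul_zero] at hl ⊢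
    exact (tendsto_nhds_unique hl tendsto_const_nhds).le
  · have hy' : 0 < ‖y‖ := norm_pos_iff.2 hy
    have h1 := hl.div_const ‖y‖
    rw [← div_le_iff₀ hy', ← h1.liminf_eq]
    refine liminf_le_liminf (Eventually.of_forall fun n => ?_) h1.isBoundedUnder_ge
      hbdd.isBoundedUnder_of_range.isCoboundedUnder_ge
    exact (div_le_iff₀ hy').2 ((T ^ n).le_opNorm y)

theorem tendsto_of_antitone_of_nonneg {f : ℕ → ℝ} (hf : Antitone f) (h0 : ∀ n, 0 ≤ f n) :
    ∃ l, Tendsto f atTop (𝓝 l) :=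
  ⟨_, tendsto_atTop_ciInf hf ⟨0, by rintro _ ⟨n, rfl⟩; exact h0 n⟩⟩

/-! ### The adjoint and the trace norm -/

namespace FaithfulNormalTrace

variable {M : Type*} [CStarAlgebra M] [PartialOrder M] [StarOrderedRing M]

theorem map_star (τ : FaithfulNormalTrace M) (x : M) : τ (star x) = star (τ x) :=
  StarHomClass.map_star τ.toPositiveLinearMap x

/-- By duality, `‖x‖₁` is the supremum of `|τ(y x)|` over `‖y‖ ≤ 1`, and
`|τ(y x⋆)| = |τ(y⋆ x)|`. -/
theorem norm₁_star_le (τ : FaithfulNormalTrace M) (x : M) : τ.norm₁ (star x) ≤ τ.norm₁ x := by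
  have key : ∀ ε : ℝ, 0 < ε → τ.norm₁ (star x) ≤ τ.norm₁ x + ε * (τ 1).re := by
    intro ε hε
    obtain ⟨y, hy, h⟩ := τ.exists_norm₁_le (star x) hε
    refine h.trans (add_le_add_left ?_ _)
    rw [show y * star x = star (x * star y) by simp, τ.map_star, norm_star, τ.comm]
    exact (τ.norm_apply_mul_le _ x).trans
      (mul_le_of_le_one_left (τ.norm₁_nonneg x) (by rwa [norm_star]))
  have hlim : Tendsto (fun ε : ℝ => τ.norm₁ x + ε * (τ 1).re) (𝓝[>] 0)
      (𝓝 (τ.norm₁ x + 0 * (τ 1).re)) :=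
    (Continuous.tendsto (by fun_prop) 0).mono_left nhdsWithin_le_nhds
  simpa using ge_of_tendsto hlim (eventually_of_mem self_mem_nhdsWithin key)

theorem im_eq_zero (τ : FaithfulNormalTrace M) {x : M} (hx : IsSelfAdjoint x) :
    (τ x).im = 0 := by
  have h := τ.map_star x
  rw [hx.star_eq] at h
  exact Complex.conj_eq_iff_im.1 h.symm

end FaithfulNormalTrace

namespace NCL1

variable {M : Type*} [CStarAlgebra M] [PartialOrder M] [StarOrderedRing M]
  {τ : FaithfulNormalTrace M}

/-! ### Positive and self-adjoint elements of `L¹(M, τ)` -/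

theorem norm_ofAlg_of_nonneg {x : M} (hx : 0 ≤ x) : ‖ofAlg τ x‖ = (τ x).re := by
  rw [norm_ofAlg, CFC.abs_of_nonneg x hx]

theorem norm_ofAlg_star_le (x : M) : ‖ofAlg τ (star x)‖ ≤ ‖ofAlg τ x‖ := by
  rw [norm_ofAlg, norm_ofAlg]
  exact τ.norm₁_star_le x

theorem norm_ofAlg_of_isSelfAdjoint {x : M} (hx : IsSelfAdjoint x) :
    ‖ofAlg τ x‖ = (τ x⁺).re + (τ x⁻).re := by
  rw [norm_ofAlg, ← CFC.posPart_add_negPart x hx, map_add, Complex.add_re]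

theorem ofAlg_mem_positiveCone {x : M} (hx : 0 ≤ x) : ofAlg τ x ∈ positiveCone τ :=
  subset_closure ⟨x, hx, rfl⟩

theorem ofAlg_mem_selfAdjointPart {x : M} (hx : IsSelfAdjoint x) :
    ofAlg τ x ∈ selfAdjointPart τ :=
  subset_closure ⟨x, hx, rfl⟩

theorem positiveCone_subset : positiveCone τ ⊆ selfAdjointPart τ :=
  closure_mono (Set.image_mono fun _ hx => IsSelfAdjoint.of_nonneg hx)

theorem sub_mem_selfAdjointPart {x y : NCL1 τ} (hx : x ∈ selfAdjointPart τ)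
    (hy : y ∈ selfAdjointPart τ) : x - y ∈ selfAdjointPart τ := by
  refine map_mem_closure₂ continuous_sub hx hy ?_
  rintro _ ⟨a, ha, rfl⟩ _ ⟨b, hb, rfl⟩
  exact ⟨a - b, IsSelfAdjoint.sub ha hb, map_sub _ _ _⟩

/-- An operator bounded by the `‖·‖₁`-norm on self-adjoint elements is bounded by twice that norm,
since the real and imaginary parts of `a ∈ M` have norm at most `‖a‖₁`. -/
theorem opNorm_le_two {S : NCL1 τ →L[ℂ] NCL1 τ}
    (hS : ∀ x ∈ selfAdjointPart τ, ‖S x‖ ≤ ‖x‖) : ‖S‖ ≤ 2 := by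
  have half : ∀ a b : NCL1 τ, ‖b‖ ≤ ‖a‖ → ‖(2 : ℂ)⁻¹ • (a + b)‖ ≤ ‖a‖ := by
    intro a b hab
    rw [norm_smul, norm_inv, Complex.norm_ofNat]
    linarith [norm_add_le a b]
  refine S.opNorm_le_bound zero_le_two fun x => ?_
  induction x using UniformSpace.Completion.induction_on with
  | hp => exact isClosed_le (by fun_prop) (by fun_prop)
  | ih z =>
    obtain ⟨a, rfl⟩ := (TraceNormed.of τ).surjective z
    change ‖S (ofAlg τ a)‖ ≤ 2 * ‖ofAlg τ a‖
    set b : M := (2 : ℂ)⁻¹ • (a + star a) with hb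
    set c : M := (2 : ℂ)⁻¹ • (-(Complex.I • a) + Complex.I • star a) with hc
    have hbs : IsSelfAdjoint b := by
      rw [IsSelfAdjoint, hb]; simp [add_comm]
    have hcs : IsSelfAdjoint c := by
      rw [IsSelfAdjoint, hc]; simp [add_comm]
    have hbn : ‖ofAlg τ b‖ ≤ ‖ofAlg τ a‖ := by
      rw [hb, map_smul, map_add]
      exact half _ _ (norm_ofAlg_star_le a)
    have hcn : ‖ofAlg τ c‖ ≤ ‖ofAlg τ a‖ := by
      have h := half (-(Complex.I • ofAlg τ a)) (Complex.I • ofAlg τ (star a))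
        (by simpa [norm_smul] using norm_ofAlg_star_le a)
      rw [hc, map_smul, map_add, map_neg, map_smul, map_smul]
      simpa [norm_smul] using h
    have hsum : a = b + Complex.I • c := by
      have hI : Complex.I • Complex.I • a = -a := by simp [smul_smul]
      have hI' : Complex.I • Complex.I • star a = -star a := by simp [smul_smul]
      rw [hb, hc, smul_comm Complex.I, smul_add Complex.I, smul_neg Complex.I, hI, hI', ← smul_add,
        show a + star a + (- -a + -star a) = (2 : ℂ) • a by rw [two_smul]; abel, smul_smul]
      simp
    calc ‖S (ofAlg τ a)‖ = ‖S (ofAlg τ b) + Complex.I • S (ofAlg τ c)‖ := by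
          rw [← map_smul, ← map_smul, ← map_add, ← map_add, ← hsum]
      _ ≤ ‖S (ofAlg τ b)‖ + ‖S (ofAlg τ c)‖ := by
          simpa [norm_smul] using norm_add_le (S (ofAlg τ b)) (Complex.I • S (ofAlg τ c))
      _ ≤ ‖ofAlg τ b‖ + ‖ofAlg τ c‖ := add_le_add (hS _ (ofAlg_mem_selfAdjointPart hbs))
          (hS _ (ofAlg_mem_selfAdjointPart hcs))
      _ ≤ 2 * ‖ofAlg τ a‖ := by linarith

/-! ### Monotonicity along the powers of `T`, and the asymptotic ratios -/

variable {T : NCL1 τ →L[ℂ] NCL1 τ}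

theorem antitone_norm_pow (hT : ∀ x ∈ selfAdjointPart τ, ‖T x‖ ≤ ‖x‖)
    (hT' : (∀ x : NCL1 τ, ‖T x‖ ≤ ‖x‖) ∨ ∀ x ∈ selfAdjointPart τ, T x ∈ selfAdjointPart τ)
    {x : NCL1 τ} (hx : x ∈ selfAdjointPart τ) : Antitone fun n : ℕ => ‖(T ^ n) x‖ := by
  refine antitone_nat_of_succ_le fun n => ?_
  rw [pow_succ', mul_apply_eq_comp]
  rcases hT' with h | h
  · exact h _
  · refine hT _ ?_
    induction n with
    | zero => simpa using hx
    | succ n ih => rw [pow_succ', mul_apply_eq_comp]; exact h _ ih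

theorem antitone_opNorm_pow (hT : ∀ x : NCL1 τ, ‖T x‖ ≤ ‖x‖) :
    Antitone fun n : ℕ => ‖T ^ n‖ := by
  refine antitone_nat_of_succ_le fun n => (T ^ (n + 1)).opNorm_le_bound (norm_nonneg _) fun x => ?_
  rw [pow_succ', mul_apply_eq_comp]
  exact (hT _).trans ((T ^ n).le_opNorm x)

theorem bddAbove_asymptoticRatios
    (hanti : ∀ x ∈ selfAdjointPart τ, Antitone fun n : ℕ => ‖(T ^ n) x‖) :
    BddAbove (asymptoticRatios T) := by
  refine ⟨1, ?_⟩
  rintro r ⟨u, hu, v, hv, -, -, hr⟩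
  refine le_of_tendsto' hr fun n => div_le_one_of_le₀ ?_ (norm_nonneg _)
  simpa using hanti _ (sub_mem_selfAdjointPart (positiveCone_subset hu) (positiveCone_subset hv))
    (Nat.zero_le n)

theorem rhoBar_nonneg (T : NCL1 τ →L[ℂ] NCL1 τ) : 0 ≤ rhoBar T := by
  refine Real.sSup_nonneg ?_
  rintro r ⟨u, -, v, -, -, -, hr⟩
  exact ge_of_tendsto' hr fun n => by positivity

theorem limit_sub_le (hbdd : BddAbove (asymptoticRatios T)) {u v : NCL1 τ}
    (hu : u ∈ positiveCone τ) (hv : v ∈ positiveCone τ) (huv : ‖u‖ = ‖v‖) {l : ℝ}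
    (hl : Tendsto (fun n : ℕ => ‖(T ^ n) (u - v)‖) atTop (𝓝 l)) :
    l ≤ rhoBar T * ‖u - v‖ := by
  rcases eq_or_ne u v with rfl | hne
  · simp only [sub_self, map_zero, norm_zero, mul_zero] at hl ⊢
    exact (tendsto_nhds_unique hl tendsto_const_nhds).le
  · rw [← div_le_iff₀ (norm_pos_iff.2 (sub_ne_zero.2 hne))]
    exact le_csSup hbdd ⟨u, hu, v, hv, huv, hne, hl.div_const _⟩

/-! ### The bound on the limit of `‖T^n x‖₁` -/

/-- The inequality for self-adjoint elements of `M` of nonnegative trace, by the decomposition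
`x = (c x⁺ - x⁻) + (1 - c) x⁺` with `c = τ(x⁻) / τ(x⁺)`. -/
theorem limit_le_of_trace_nonneg
    (hanti : ∀ x ∈ selfAdjointPart τ, Antitone fun n : ℕ => ‖(T ^ n) x‖)
    (hbdd : BddAbove (Set.range fun n : ℕ => ‖T ^ n‖)) {x : M} (hx : IsSelfAdjoint x)
    (hτ : 0 ≤ (τ x).re) {l : ℝ} (hl : Tendsto (fun n : ℕ => ‖(T ^ n) (ofAlg τ x)‖) atTop (𝓝 l)) :
    l ≤ rhoBar T * ‖ofAlg τ x‖ + rho T * (τ x).re := by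
  have hp : 0 ≤ x⁺ := CFC.posPart_nonneg x
  have hm : 0 ≤ x⁻ := CFC.negPart_nonneg x
  have hxpm : x⁺ - x⁻ = x := CFC.posPart_sub_negPart x hx
  have hτx : (τ x).re = (τ x⁺).re - (τ x⁻).re := by
    conv_lhs => rw [← hxpm, map_sub, Complex.sub_re]
  have hp' : 0 ≤ (τ x⁺).re := τ.re_nonneg hp
  have hm' : 0 ≤ (τ x⁻).re := τ.re_nonneg hm
  have hnorm := norm_ofAlg_of_isSelfAdjoint (τ := τ) hx
  set c : ℝ := (τ x⁻).re / (τ x⁺).re with hc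
  have hc0 : 0 ≤ c := div_nonneg hm' hp'
  have hc1 : c ≤ 1 := div_le_one_of_le₀ (by linarith) hp'
  -- If `τ(x⁺) = 0` then also `τ(x⁻) = 0`, so the junk value `c = 0` does no harm.
  have hcp : c * (τ x⁺).re = (τ x⁻).re := by
    rcases hp'.eq_or_lt with h | h
    · rw [← h, mul_zero]; linarith
    · exact div_mul_cancel₀ _ h.ne'
  have hu0 : 0 ≤ c • x⁺ := smul_nonneg hc0 hp
  have hw0 : 0 ≤ (1 - c) • x⁺ := smul_nonneg (sub_nonneg.2 hc1) hp
  have hun : ‖ofAlg τ (c • x⁺)‖ = (τ x⁻).re := by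
    rw [norm_ofAlg_of_nonneg hu0, τ.re_smul, hcp]
  have hvn : ‖ofAlg τ x⁻‖ = (τ x⁻).re := norm_ofAlg_of_nonneg hm
  have hwn : ‖ofAlg τ ((1 - c) • x⁺)‖ = (τ x).re := by
    rw [norm_ofAlg_of_nonneg hw0, τ.re_smul, sub_mul, hcp, one_mul, hτx]
  have hu := ofAlg_mem_positiveCone (τ := τ) hu0
  have hv := ofAlg_mem_positiveCone (τ := τ) hm
  have hw := ofAlg_mem_positiveCone (τ := τ) hw0
  have hdecomp : ofAlg τ x = (ofAlg τ (c • x⁺) - ofAlg τ x⁻) + ofAlg τ ((1 - c) • x⁺) := by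
    rw [← map_sub, ← map_add, sub_smul, one_smul]
    congr 1
    conv_lhs => rw [← hxpm]
    abel
  obtain ⟨l₁, hl₁⟩ := tendsto_of_antitone_of_nonneg
    (hanti _ (sub_mem_selfAdjointPart (positiveCone_subset hu) (positiveCone_subset hv)))
    fun n => norm_nonneg _
  obtain ⟨l₂, hl₂⟩ := tendsto_of_antitone_of_nonneg (hanti _ (positiveCone_subset hw))
    fun n => norm_nonneg _
  have h12 : l ≤ l₁ + l₂ := by
    refine le_of_tendsto_of_tendsto' hl (hl₁.add hl₂) fun n => ?_
    rw [hdecomp, map_add]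
    exact norm_add_le _ _
  have h1 : l₁ ≤ rhoBar T * (2 * (τ x⁻).re) := by
    refine (limit_sub_le (bddAbove_asymptoticRatios hanti) hu hv (hun.trans hvn.symm) hl₁).trans
      (mul_le_mul_of_nonneg_left ((norm_sub_le _ _).trans ?_) (rhoBar_nonneg T))
    rw [hun, hvn, two_mul]
  have h2 : l₂ ≤ asymptoticNorm T * (τ x).re := by
    rw [← hwn]
    exact ContinuousLinearMap.le_liminf_norm_pow_mul hbdd hl₂
  calc l ≤ rhoBar T * (2 * (τ x⁻).re) + asymptoticNorm T * (τ x).re := by linarith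
    _ = rhoBar T * ‖ofAlg τ x‖ + rho T * (τ x).re := by rw [rho, hnorm, hτx]; ring

theorem limit_le_of_isSelfAdjoint
    (hanti : ∀ x ∈ selfAdjointPart τ, Antitone fun n : ℕ => ‖(T ^ n) x‖)
    (hbdd : BddAbove (Set.range fun n : ℕ => ‖T ^ n‖)) {x : M} (hx : IsSelfAdjoint x)
    {l : ℝ} (hl : Tendsto (fun n : ℕ => ‖(T ^ n) (ofAlg τ x)‖) atTop (𝓝 l)) :
    l ≤ rhoBar T * ‖ofAlg τ x‖ + rho T * ‖trace τ (ofAlg τ x)‖ := by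
  have hre : ‖trace τ (ofAlg τ x)‖ = |(τ x).re| := by
    rw [trace_ofAlg]
    exact (Complex.abs_re_eq_norm.2 (τ.im_eq_zero hx)).symm
  rw [hre]
  rcases le_total 0 (τ x).re with h | h
  · rw [abs_of_nonneg h]
    exact limit_le_of_trace_nonneg hanti hbdd hx h hl
  · have := limit_le_of_trace_nonneg (x := -x) hanti hbdd hx.neg (l := l)
      (by rw [map_neg, Complex.neg_re]; linarith) (by simpa using hl)
    simpa [abs_of_nonpos h] using this

theorem limit_le (hanti : ∀ x ∈ selfAdjointPart τ, Antitone fun n : ℕ => ‖(T ^ n) x‖)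
    (hbdd : BddAbove (Set.range fun n : ℕ => ‖T ^ n‖)) {x : NCL1 τ}
    (hx : x ∈ selfAdjointPart τ) {l : ℝ}
    (hl : Tendsto (fun n : ℕ => ‖(T ^ n) x‖) atTop (𝓝 l)) :
    l ≤ rhoBar T * ‖x‖ + rho T * ‖trace τ x‖ := by
  -- Replacing `x` by `y` changes the limit by at most `‖x - y‖`; then let `y → x`.
  have key : ∀ y ∈ ofAlg τ '' {a : M | IsSelfAdjoint a},
      l ≤ rhoBar T * ‖y‖ + rho T * ‖trace τ y‖ + ‖x - y‖ := by
    rintro _ ⟨a, ha, rfl⟩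
    have hmem := ofAlg_mem_selfAdjointPart (τ := τ) ha
    obtain ⟨l', hl'⟩ := tendsto_of_antitone_of_nonneg (hanti _ hmem) fun n => norm_nonneg _
    refine (le_of_tendsto_of_tendsto' hl (hl'.add_const ‖x - ofAlg τ a‖) fun n => ?_).trans
      (add_le_add_left (limit_le_of_isSelfAdjoint hanti hbdd ha hl') _)
    have h1 := hanti _ (sub_mem_selfAdjointPart hx hmem) (Nat.zero_le n)
    simp only [pow_zero, one_apply_eq_self] at h1
    calc ‖(T ^ n) x‖ = ‖(T ^ n) (ofAlg τ a) + (T ^ n) (x - ofAlg τ a)‖ := by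
          rw [← map_add, add_sub_cancel]
      _ ≤ _ := (norm_add_le _ _).trans (add_le_add_right h1 _)
  have hclosed : IsClosed {y : NCL1 τ | l ≤ rhoBar T * ‖y‖ + rho T * ‖trace τ y‖ + ‖x - y‖} :=
    isClosed_le continuous_const (by fun_prop)
  have h : l ≤ rhoBar T * ‖x‖ + rho T * ‖trace τ x‖ + ‖x - x‖ := closure_minimal key hclosed hx
  simpa using h

end NCL1

theorem theorem4p1 {M : Type*} [CStarAlgebra M] [WStarAlgebra M] [PartialOrder M]
    [StarOrderedRing M] (τ : FaithfulNormalTrace M) (T : NCL1 τ →L[ℂ] NCL1 τ)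
    (hT : ∀ x ∈ NCL1.selfAdjointPart τ, ‖T x‖ ≤ ‖x‖)
    (hT' : (∀ x : NCL1 τ, ‖T x‖ ≤ ‖x‖) ∨
      ∀ x ∈ NCL1.selfAdjointPart τ, T x ∈ NCL1.selfAdjointPart τ) :
    BddAbove (NCL1.asymptoticRatios T) ∧
    BddAbove (Set.range fun n : ℕ => ‖T ^ n‖) ∧
    ((∀ x : NCL1 τ, ‖T x‖ ≤ ‖x‖) →
      Filter.Tendsto (fun n : ℕ => ‖T ^ n‖) Filter.atTop (nhds (NCL1.asymptoticNorm T))) ∧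
    ∀ x ∈ NCL1.selfAdjointPart τ, ∃ l : ℝ,
      Filter.Tendsto (fun n : ℕ => ‖(T ^ n) x‖) Filter.atTop (nhds l) ∧
      l ≤ NCL1.rhoBar T * ‖x‖ + NCL1.rho T * ‖NCL1.trace τ x‖ := by
  have hanti := fun x (hx : x ∈ NCL1.selfAdjointPart τ) => NCL1.antitone_norm_pow hT hT' hx
  have hbdd : BddAbove (Set.range fun n : ℕ => ‖T ^ n‖) := by
    refine ⟨2, ?_⟩
    rintro _ ⟨n, rfl⟩
    exact NCL1.opNorm_le_two fun x hx => by simpa using hanti x hx (Nat.zero_le n)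
  refine ⟨NCL1.bddAbove_asymptoticRatios hanti, hbdd, fun h => ?_, fun x hx => ?_⟩
  · obtain ⟨l, hl⟩ := tendsto_of_antitone_of_nonneg (NCL1.antitone_opNorm_pow h)
      fun n => norm_nonneg _
    rwa [NCL1.asymptoticNorm, hl.liminf_eq]
  · obtain ⟨l, hl⟩ := tendsto_of_antitone_of_nonneg (hanti x hx) fun n => norm_nonneg _
    exact ⟨l, hl, NCL1.limit_le hanti hbdd hx hl⟩
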